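/- Let $X$ be a real locally convex space with topological dual $X^*$, and let $X^*$ carry any locally convex topology compatible with the duality (that is, its continuous linear functionals are exactly the evaluations $x^*\mapsto\langle x^*,x\rangle$, $x\in X$); $\overline{\operatorname{co}}$ denotes the closed convex hull in $X^*$ for this topology. For $g:X\to\overline{\mathbb R}=\mathbb R\cup\{\pm\infty\}$ write $[g\le 0]=\{x\in X: g(x)\le 0\}$, and call $g$ quasi-convex if $\{x\in X:g(x)\le c\}$ is convex for every $c\in\mathbb R$. For $A\subset X$, $x\in A$ and $\varepsilon\ge 0$, let $$\mathrm N^{\varepsilon}_A(x)=\{x^*\in X^*:\langle x^*,y-x\rangle\le\varepsilon\ \text{ for all } y\in A\},$$ i.e. the $\varepsilon$-subdifferential at $x$ of the indicator function of $A$ ($0$ on $A$, $+\infty$ outside $A$), and let $\mathrm N_A(x)=\mathrm N^0_A(x)$ be the normal cone. The recession cone of a nonempty closed convex set $C$ is $[C]_\infty=\bigcap_{s>0}s(C-c)$, where $c\in C$ is arbitrary. Let $T$ be an arbitrary index set, let $f_t:X\to\overline{\mathbb R}$, $t\in T$, be quasi-convex functions, and put $f=\sup_{t\in T}f_t$. Assume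 that $$\operatorname{cl}[f\le 0]=\bigcap_{t\in T}\operatorname{cl}[f_t\le 0].$$ Then, for every $x\in[f\le 0]$ with $f(x)\in\mathbb R$, $$\mathrm N_{[f\le 0]}(x)=\Big[\overline{\operatorname{co}}\Big(\bigcup_{t\in T}\mathrm N^{\varepsilon}_{[f_t\le 0]}(x)\Big)\Big]_\infty\quad\text{for every }\varepsilon>0,$$ and, consequently, $$\mathrm N_{[f\le 0]}(x)=\bigcap_{\varepsilon>0}\overline{\operatorname{co}}\Big(\bigcup_{t\in T}\mathrm N^{\varepsilon}_{[f_t\le 0]}(x)\Big).$$ -/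

import Mathlib

open scoped Pointwise Topology

noncomputable section

namespace NormalCone

/-- The sublevel set `[f ≤ c]` of an extended-real-valued function. -/
def sublevel {X : Type*} (f : X → EReal) (c : ℝ) : Set X := {x | f x ≤ (c : EReal)}

/-- The indicator function of a set in the sense of convex analysis:
`0` on the set and `+∞` outside it. -/
def indicatorFn {X : Type*} (A : Set X) : X → EReal :=
  open Classical in fun x => if x ∈ A then 0 else ⊤

/-- The `ε`-subdifferential of `f` at `x`; it is empty unless `f x` is a real number. -/
def epsSubdifferential {X : Type*} [AddCommGroup X] [Module ℝ X] [TopologicalSpace X]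
    (f : X → EReal) (ε : ℝ) (x : X) : Set (StrongDual ℝ X) :=
  {xs | (∃ r : ℝ, f x = (r : EReal)) ∧
    ∀ y : X, ((xs (y - x) : ℝ) : EReal) ≤ f y - f x + (ε : EReal)}

/-- The `ε`-normal set to `A` at `x`. -/
def epsNormalSet {X : Type*} [AddCommGroup X] [Module ℝ X] [TopologicalSpace X]
    (A : Set X) (ε : ℝ) (x : X) : Set (StrongDual ℝ X) :=
  epsSubdifferential (indicatorFn A) ε x

/-- The normal cone to `A` at `x`. -/
def normalCone {X : Type*} [AddCommGroup X] [Module ℝ X] [TopologicalSpace X]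
    (A : Set X) (x : X) : Set (StrongDual ℝ X) :=
  epsNormalSet A 0 x

/-- The recession cone `⋂_{t > 0} t (A - a)` of a closed convex set `A`, where `a` is any point
of `A` (see `recessionCone_eq` for the independence of the chosen point); the recession cone of
the empty set is `{0}`. -/
def recessionCone {E : Type*} [AddCommGroup E] [Module ℝ E] (A : Set E) : Set E :=
  open Classical in
  if h : A.Nonempty then ⋂ t ∈ Set.Ioi (0 : ℝ), t • (A - {h.some}) else {0}

/-- A topology `τ` on the topological dual `X*` of `X` is compatible with the duality between `X`
and `X*` if it is a locally convex vector space topology whose continuous linear functionals are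
exactly the evaluations at the points of `X`. -/
structure IsCompatibleDualTopology {X : Type*} [AddCommGroup X] [Module ℝ X] [TopologicalSpace X]
    [IsTopologicalAddGroup X] [ContinuousSMul ℝ X]
    (τ : TopologicalSpace (StrongDual ℝ X)) : Prop where
  isTopologicalAddGroup : @IsTopologicalAddGroup (StrongDual ℝ X) τ _
  continuousSMul : @ContinuousSMul ℝ (StrongDual ℝ X) _ _ τ
  locallyConvexSpace : @LocallyConvexSpace ℝ (StrongDual ℝ X) _ _ _ _ τ
  continuous_iff : ∀ φ : StrongDual ℝ X →ₗ[ℝ] ℝ,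
    Continuous[τ, inferInstance] φ ↔ ∃ x : X, ∀ xs : StrongDual ℝ X, φ xs = xs x

theorem mem_iInter_smul_sub_iff {E : Type*} [AddCommGroup E] [Module ℝ E] (A : Set E) (a d : E) :
    d ∈ ⋂ t ∈ Set.Ioi (0 : ℝ), t • (A - {a}) ↔ ∀ s : ℝ, 0 < s → a + s • d ∈ A := by
  simp only [Set.mem_iInter, Set.mem_Ioi]
  constructor
  · intro h s hs
    have := h s⁻¹ (inv_pos.2 hs)
    rw [Set.mem_smul_set_iff_inv_smul_mem₀ (inv_pos.2 hs).ne', inv_inv] at this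
    obtain ⟨b, hb, c, hc, hbc⟩ := this
    rw [Set.mem_singleton_iff] at hc
    subst hc
    have hbc' : b - c = s • d := hbc
    rw [← hbc']
    simpa using hb
  · intro h t ht
    rw [Set.mem_smul_set_iff_inv_smul_mem₀ ht.ne']
    exact ⟨a + t⁻¹ • d, h _ (inv_pos.2 ht), a, rfl, by simp⟩

theorem recession_basepoint {E : Type*} [AddCommGroup E] [Module ℝ E] [TopologicalSpace E]
    [IsTopologicalAddGroup E] [ContinuousSMul ℝ E] {A : Set E} (hc : IsClosed A)
    (hA : Convex ℝ A) {a b d : E} (hb : b ∈ A)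
    (h : ∀ s : ℝ, 0 < s → a + s • d ∈ A) : ∀ s : ℝ, 0 < s → b + s • d ∈ A := by
  intro s hs
  have hcont : Continuous fun l : ℝ => (1 - l) • b + (l • a + s • d) := by fun_prop
  have hlim : Filter.Tendsto (fun l : ℝ => (1 - l) • b + (l • a + s • d)) (𝓝[>] 0)
      (𝓝 (b + s • d)) := by
    have := (hcont.tendsto 0).mono_left (nhdsWithin_le_nhds (s := Set.Ioi 0))
    simpa using this
  refine hc.mem_of_tendsto hlim ?_
  filter_upwards [Ioo_mem_nhdsGT (zero_lt_one' ℝ)] with l hl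
  have h1 := h (s / l) (div_pos hs hl.1)
  have h2 := hA hb h1 (sub_nonneg.2 hl.2.le) hl.1.le (by ring)
  have h3 : l * (s / l) = s := by field_simp [hl.1.ne']
  rwa [smul_add, smul_smul, h3] at h2

theorem recessionCone_eq {E : Type*} [AddCommGroup E] [Module ℝ E] [TopologicalSpace E]
    [IsTopologicalAddGroup E] [ContinuousSMul ℝ E] {A : Set E} (hc : IsClosed A)
    (hA : Convex ℝ A) {a : E} (ha : a ∈ A) :
    recessionCone A = ⋂ t ∈ Set.Ioi (0 : ℝ), t • (A - {a}) := by
  have hne : A.Nonempty := ⟨a, ha⟩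
  ext d
  rw [recessionCone, dif_pos hne, mem_iInter_smul_sub_iff, mem_iInter_smul_sub_iff]
  exact ⟨recession_basepoint hc hA ha, recession_basepoint hc hA hne.some_mem⟩

end NormalCone

end

namespace NormalCone

section Dual

variable {X : Type*} [AddCommGroup X] [Module ℝ X] [TopologicalSpace X]

/-- The `ε`-normal set at a point of `A`, as a set of linear inequalities. -/
theorem mem_epsNormalSet_iff {A : Set X} {ε : ℝ} {x : X} (hx : x ∈ A) {xs : StrongDual ℝ X} :
    xs ∈ epsNormalSet A ε x ↔ ∀ y ∈ A, xs (y - x) ≤ ε := by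
  simp only [epsNormalSet, epsSubdifferential, indicatorFn, Set.mem_ofPred_eq, if_pos hx, sub_zero]
  constructor
  · rintro ⟨-, h⟩ y hy
    have := h y
    rw [if_pos hy, zero_add] at this
    exact_mod_cast this
  · refine fun h => ⟨⟨0, rfl⟩, fun y => ?_⟩
    by_cases hy : y ∈ A
    · rw [if_pos hy, zero_add]
      exact_mod_cast h y hy
    · rw [if_neg hy, EReal.top_add_coe]
      exact le_top

theorem convex_epsNormalSet {A : Set X} {ε : ℝ} {x : X} (hx : x ∈ A) :
    Convex ℝ (epsNormalSet A ε x) := by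
  intro a ha b hb s t hs ht hst
  rw [mem_epsNormalSet_iff hx] at *
  intro y hy
  have h1 := mul_le_mul_of_nonneg_left (ha y hy) hs
  have h2 := mul_le_mul_of_nonneg_left (hb y hy) ht
  simp only [add_apply, smul_apply, smul_eq_mul]
  calc _ ≤ s * ε + t * ε := add_le_add h1 h2
    _ = ε := by rw [← add_mul, hst, one_mul]

variable [IsTopologicalAddGroup X]

/-- The linear inequality defining an `ε`-normal extends to the closure of the set. -/
theorem apply_sub_le_of_mem_closure {A : Set X} {ε : ℝ} {x : X} {xs : StrongDual ℝ X}
    (h : ∀ y ∈ A, xs (y - x) ≤ ε) {y : X} (hy : y ∈ closure A) : xs (y - x) ≤ ε := by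
  have hc : IsClosed {y | xs (y - x) ≤ ε} :=
    isClosed_le (xs.continuous.comp (continuous_id.sub continuous_const)) continuous_const
  exact closure_minimal h hc hy

variable [ContinuousSMul ℝ X] [LocallyConvexSpace ℝ X]

/-- The bipolar theorem for a convex set, with base point `x` and level `ε > 0`. -/
theorem add_mem_closure_of_forall_epsNormalSet {A : Set X} (hA : Convex ℝ A) {x : X} (hx : x ∈ A)
    {ε : ℝ} (hε : 0 < ε) {z : X} (hz : ∀ xs ∈ epsNormalSet A ε x, xs z ≤ ε) :
    x + z ∈ closure A := by
  by_contra hmem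
  obtain ⟨g, v, hgv, hvg⟩ := geometric_hahn_banach_closed_point hA.closure isClosed_closure hmem
  have hw : 0 < v - g x := sub_pos.2 (hgv x (subset_closure hx))
  have hmul : ∀ r, (ε / (v - g x)) * r ≤ ε ↔ r ≤ v - g x := fun r => by
    rw [div_mul_eq_mul_div, div_le_iff₀ hw, mul_le_mul_iff_right₀ hε]
  have h1 : (ε / (v - g x)) • g ∈ epsNormalSet A ε x := by
    refine (mem_epsNormalSet_iff hx).2 fun y hy => ?_
    have := hgv y (subset_closure hy)
    simp only [smul_apply, smul_eq_mul, hmul]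
    rw [map_sub]
    linarith
  have h2 := hz _ h1
  simp only [smul_apply, smul_eq_mul, hmul] at h2
  rw [map_add] at hvg
  linarith

end Dual

/-- Separation of a point from a closed convex set by a continuous linear functional, with the
functional as a plain linear map. -/
theorem exists_linearMap_separating {E : Type*} [AddCommGroup E] [Module ℝ E] [TopologicalSpace E]
    [IsTopologicalAddGroup E] [ContinuousSMul ℝ E] [LocallyConvexSpace ℝ E] {S : Set E}
    (hS : Convex ℝ S) {d : E} (hd : d ∉ closure S) :
    ∃ φ : E →ₗ[ℝ] ℝ, Continuous φ ∧ ∃ u : ℝ, (∀ a ∈ closure S, φ a < u) ∧ u < φ d := by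
  obtain ⟨φ, u, h1, h2⟩ := geometric_hahn_banach_closed_point hS.closure isClosed_closure hd
  exact ⟨φ, φ.continuous, u, h1, h2⟩

section Compatible

variable {X : Type*} [AddCommGroup X] [Module ℝ X] [TopologicalSpace X]
  [IsTopologicalAddGroup X] [ContinuousSMul ℝ X]

/-- Evaluations are continuous for a compatible topology on the dual. -/
theorem IsCompatibleDualTopology.continuous_eval {τ : TopologicalSpace (StrongDual ℝ X)}
    (hτ : IsCompatibleDualTopology τ) (z : X) :
    Continuous[τ, inferInstance] fun xs : StrongDual ℝ X => xs z :=
  (hτ.continuous_iff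
    { toFun := fun xs => xs z, map_add' := fun _ _ => rfl, map_smul' := fun _ _ => rfl }).2
    ⟨z, fun _ => rfl⟩

theorem IsCompatibleDualTopology.isClosed_epsNormalSet {τ : TopologicalSpace (StrongDual ℝ X)}
    (hτ : IsCompatibleDualTopology τ) {A : Set X} {ε : ℝ} {x : X} (hx : x ∈ A) :
    IsClosed[τ] (epsNormalSet A ε x) := by
  have h : epsNormalSet A ε x = ⋂ y ∈ A, {xs : StrongDual ℝ X | xs (y - x) ≤ ε} := by
    ext xs
    simp [mem_epsNormalSet_iff hx]
  rw [h]
  exact @isClosed_biInter _ _ τ _ _ fun y _ =>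
    @IsClosed.preimage _ _ τ _ _ (hτ.continuous_eval (y - x)) _ isClosed_Iic

/-- The normal cone is the recession cone of each `ε`-normal set, `ε ≥ 0`. -/
theorem IsCompatibleDualTopology.recessionCone_epsNormalSet
    {τ : TopologicalSpace (StrongDual ℝ X)} (hτ : IsCompatibleDualTopology τ) {B : Set X} {x : X}
    (hx : x ∈ B) {ε : ℝ} (hε : 0 ≤ ε) :
    recessionCone (epsNormalSet B ε x) = normalCone B x := by
  have h0 : (0 : StrongDual ℝ X) ∈ epsNormalSet B ε x :=
    (mem_epsNormalSet_iff hx).2 fun y _ => hε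
  ext d
  rw [@recessionCone_eq _ _ _ τ hτ.isTopologicalAddGroup hτ.continuousSMul _
    (hτ.isClosed_epsNormalSet hx) (convex_epsNormalSet hx) _ h0, mem_iInter_smul_sub_iff,
    normalCone, mem_epsNormalSet_iff hx]
  simp only [zero_add, mem_epsNormalSet_iff hx, smul_apply, smul_eq_mul]
  constructor
  · intro h y hy
    by_contra! hpos
    have := h ((ε + 1) / d (y - x)) (by positivity) y hy
    rw [div_mul_cancel₀ _ hpos.ne'] at this
    linarith
  · intro h s hs y hy
    exact (mul_nonpos_of_nonneg_of_nonpos hs.le (h y hy)).trans hε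

variable [LocallyConvexSpace ℝ X]

/-- For `ε > 0`, the `ε`-normal set to `B` is the closed convex hull of the union of the
`ε`-normal sets to the convex sets `A t`, provided the closure of `B` is the intersection of the
closures of the `A t`. -/
theorem IsCompatibleDualTopology.closure_convexHull_iUnion_epsNormalSet
    {τ : TopologicalSpace (StrongDual ℝ X)} (hτ : IsCompatibleDualTopology τ)
    {T : Type*} [Nonempty T] {A : T → Set X} (hA : ∀ t, Convex ℝ (A t)) {B : Set X}
    (hcl : closure B = ⋂ t, closure (A t)) {x : X} (hxB : x ∈ B) (hxA : ∀ t, x ∈ A t)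
    {ε : ℝ} (hε : 0 < ε) :
    closure[τ] (convexHull ℝ (⋃ t, epsNormalSet (A t) ε x)) = epsNormalSet B ε x := by
  have := hτ.isTopologicalAddGroup
  have := hτ.continuousSMul
  have := hτ.locallyConvexSpace
  apply Set.Subset.antisymm
  · refine @closure_minimal _ τ _ _ (convexHull_min (Set.iUnion_subset fun t xs hxs => ?_)
      (convex_epsNormalSet hxB)) (hτ.isClosed_epsNormalSet hxB)
    rw [mem_epsNormalSet_iff (hxA t)] at hxs
    refine (mem_epsNormalSet_iff hxB).2 fun y hy => apply_sub_le_of_mem_closure hxs ?_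
    exact Set.mem_iInter.1 (hcl ▸ subset_closure hy) t
  · intro d hd
    rw [mem_epsNormalSet_iff hxB] at hd
    by_contra hmem
    obtain ⟨φ, hφ, u, hu, hud⟩ :=
      @exists_linearMap_separating _ _ _ τ _ _ _ _ (convex_convexHull ℝ _) d hmem
    obtain ⟨z, hz⟩ := (hτ.continuous_iff φ).1 hφ
    have hsub : ∀ t, ∀ xs ∈ epsNormalSet (A t) ε x, xs z < u := fun t xs hxs =>
      hz xs ▸ hu xs (@subset_closure _ τ _ _ (subset_convexHull ℝ _ (Set.mem_iUnion_of_mem t hxs)))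
    have hu0 : 0 < u := by
      obtain ⟨t⟩ := ‹Nonempty T›
      exact hsub t 0 ((mem_epsNormalSet_iff (hxA t)).2 fun y _ => hε.le)
    rw [hz] at hud
    have hmul : ∀ r, (ε / u) * r ≤ ε ↔ r ≤ u := fun r => by
      rw [div_mul_eq_mul_div, div_le_iff₀ hu0, mul_le_mul_iff_right₀ hε]
    have hmemB : x + (ε / u) • z ∈ closure B := by
      rw [hcl]
      refine Set.mem_iInter.2 fun t =>
        add_mem_closure_of_forall_epsNormalSet (hA t) (hxA t) hε fun xs hxs => ?_
      rw [map_smul, smul_eq_mul, hmul]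
      exact (hsub t xs hxs).le
    have h := apply_sub_le_of_mem_closure hd hmemB
    rw [add_sub_cancel_left, map_smul, smul_eq_mul, hmul] at h
    exact h.not_gt hud

end Compatible

theorem iInter_epsNormalSet {X : Type*} [AddCommGroup X] [Module ℝ X] [TopologicalSpace X]
    {B : Set X} {x : X} (hx : x ∈ B) :
    ⋂ ε ∈ Set.Ioi (0 : ℝ), epsNormalSet B ε x = normalCone B x := by
  ext d
  simp only [Set.mem_iInter, Set.mem_Ioi, normalCone, mem_epsNormalSet_iff hx]
  exact ⟨fun h y hy => le_of_forall_pos_le_add fun ε hε => by simpa using h ε hε y hy,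
    fun h ε hε y hy => (h y hy).trans hε.le⟩

end NormalCone

theorem mainTheorem3 {X : Type*} [AddCommGroup X] [Module ℝ X] [TopologicalSpace X]
    [IsTopologicalAddGroup X] [ContinuousSMul ℝ X] [LocallyConvexSpace ℝ X]
    (τ : TopologicalSpace (StrongDual ℝ X)) (hτ : NormalCone.IsCompatibleDualTopology τ)
    {T : Type*} (f : T → X → EReal) (hf : ∀ t, QuasiconvexOn ℝ Set.univ (f t))
    (hcl : closure (NormalCone.sublevel (⨆ t, f t) 0) =
      ⋂ t, closure (NormalCone.sublevel (f t) 0))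
    (x : X) (hx : x ∈ NormalCone.sublevel (⨆ t, f t) 0)
    (hfin : ∃ r : ℝ, (⨆ t, f t) x = (r : EReal)) :
    (∀ ε : ℝ, 0 < ε →
      NormalCone.normalCone (NormalCone.sublevel (⨆ t, f t) 0) x =
        NormalCone.recessionCone (closure[τ] (convexHull ℝ
          (⋃ t, NormalCone.epsNormalSet (NormalCone.sublevel (f t) 0) ε x)))) ∧
    NormalCone.normalCone (NormalCone.sublevel (⨆ t, f t) 0) x =
      ⋂ ε ∈ Set.Ioi (0 : ℝ), closure[τ] (convexHull ℝ
        (⋃ t, NormalCone.epsNormalSet (NormalCone.sublevel (f t) 0) ε x)) := by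
  have hT : Nonempty T := by
    by_contra hT
    rw [not_nonempty_iff] at hT
    obtain ⟨r, hr⟩ := hfin
    rw [iSup_of_empty] at hr
    exact EReal.coe_ne_bot r hr.symm
  have hconv : ∀ t, Convex ℝ (NormalCone.sublevel (f t) 0) := fun t => by
    simpa [NormalCone.sublevel] using hf t 0
  have hxt : ∀ t, x ∈ NormalCone.sublevel (f t) 0 := fun t => (le_iSup f t x).trans hx
  have key : ∀ ε : ℝ, 0 < ε → closure[τ] (convexHull ℝ
      (⋃ t, NormalCone.epsNormalSet (NormalCone.sublevel (f t) 0) ε x)) =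
        NormalCone.epsNormalSet (NormalCone.sublevel (⨆ t, f t) 0) ε x := fun ε hε =>
    hτ.closure_convexHull_iUnion_epsNormalSet hconv hcl hx hxt hε
  refine ⟨fun ε hε => ?_, ?_⟩
  · rw [key ε hε, hτ.recessionCone_epsNormalSet hx hε.le]
  · rw [← NormalCone.iInter_epsNormalSet hx]
    exact Set.iInter₂_congr fun ε hε => (key ε hε).symm
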